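/- Let $V$ be a finite set of variables, split into observables $X$ and parameters $\Theta = V\setminus X$. Each variable $v$ takes values in a measurable space with a $\sigma$-finite reference measure $\mu_v$, and the variables have a joint probability density $p$ with respect to $\mu=\bigotimes_v\mu_v$. For disjoint sets of variables $S,T$ write $p(S)$ for the marginal density of $S$ and $p(S\mid T)=p(S,T)/p(T)$ for the conditional density, read as $0$ where numerator and denominator both vanish. Let $G$ be a directed acyclic graph on $V$ with respect to which $p$ has the Markov factorization property, i.e. $p=\prod_{v\in V}p(v\mid \mathrm{pa}(v))$ $\mu$-almost everywhere, where $\mathrm{pa}(v)$ is the set of parents of $v$. For a set $S\subseteq V$ let $\mathrm{pa}(S)$ be the set of nodes outside $S$ that have an edge into $S$. Let $X=X_A^\ast\cup X_B^\ast$ be a partition of the observables into two disjoint sets. For $I\in\{A,B\}$, the module $\Psi_I\subseteq V$ is formed as follows. It contains $X_I^\ast$. Moreover, for each directed path of $G$ with leaf (end node) in $X_I^\ast$, with components labelled $\psi_1,\dots,\psi_s$ from the leaf $\psi_1$ backwards to the root $\psi_s$: if $\psi_r$ is the first component that lies in $X\setminus X_I^\ast$, then $\psi_1,\dots,\psi_r$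 belong to $\Psi_I$; if no component lies in $X\setminus X_I^\ast$, then all of $\psi_1,\dots,\psi_s$ belong to $\Psi_I$. Write $\Theta_A=\Theta\cap\Psi_A$, $\Theta_B=\Theta\cap\Psi_B$, $\Theta_{A\cap B}=\Theta\cap\Psi_A\cap\Psi_B$, $\Theta_{A\setminus B}=\Theta\cap(\Psi_A\setminus\Psi_B)$, $\Theta_{B\setminus A}=\Theta\cap(\Psi_B\setminus\Psi_A)$, $\Theta_{(A\cup B)^{\mathsf c}}=\Theta\setminus(\Psi_A\cup\Psi_B)$, and similarly $X_{A\cap B}$, $X_{A\setminus B}$, $X_{B\setminus A}$ for the observables. Then, $\mu$-almost everywhere, the standard posterior density of $\Theta$ satisfies both \[ p(\Theta\mid X)= p\bigl(\Theta_{(A\cup B)^{\mathsf c}}\mid \mathrm{pa}(\Theta_{(A\cup B)^{\mathsf c}})\bigr)\, p\bigl(\Theta_{B\setminus A}\mid \Theta_{A\cap B},X_{B\setminus A},X_{A\cap B}\bigr)\, p(\Theta_A\mid X) \] and \[ p(\Theta\mid X)= p\bigl(\Theta_{(A\cup B)^{\mathsf c}}\mid \mathrm{pa}(\Theta_{(A\cup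 B)^{\mathsf c}})\bigr)\, p\bigl(\Theta_{A\setminus B}\mid \Theta_{A\cap B},X_{A\setminus B},X_{A\cap B}\bigr)\, p(\Theta_B\mid X). \] -/

import Mathlib

open MeasureTheory
open scoped ENNReal

namespace CutInference

/-! Directed acyclic graphs and modules. -/

section Graph

variable {V : Type*}

/-- A directed graph is acyclic (a DAG) if no node can be reached from itself along a nonempty
sequence of edges. -/
def IsDAG (G : Digraph V) : Prop :=
  ∀ v : V, ¬ Relation.TransGen G.Adj v v

/-- `IsPathInto G ψ s` : the nodes `ψ 1, ψ 2, …, ψ s` (with `2 ≤ s`) are the components of a directed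
path `ψ s ⇝ ψ 1`, labelled from its leaf `ψ 1` to its root `ψ s`, so that each edge goes from
`ψ (i + 1)` to `ψ i`. In a DAG the two ends are automatically distinct. -/
def IsPathInto (G : Digraph V) (ψ : ℕ → V) (s : ℕ) : Prop :=
  2 ≤ s ∧ ∀ i, 1 ≤ i → i < s → G.Adj (ψ (i + 1)) (ψ i)

variable [Fintype V] [DecidableEq V]

open scoped Classical in
/-- The set `pa(v)` of parents of a node. -/
noncomputable def nodeParents (G : Digraph V) (v : V) : Finset V :=
  Finset.univ.filter fun a => G.Adj a v

open scoped Classical in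
/-- The set `pa(S)` of parents of a set of nodes; nodes of `S` itself are excluded. -/
noncomputable def parents (G : Digraph V) (S : Finset V) : Finset V :=
  Finset.univ.filter fun a => a ∉ S ∧ ∃ b ∈ S, G.Adj a b

/-- The nodes that are added to the module started from the observables `XA` (out of all
observables `X`). For each directed path `b ⇝ a` with leaf `a ∈ XA`, with components
`a = ψ 1, …, ψ s = b` : if `ψ r` (`r > 1`) is the first component in `X \ XA`, then `ψ 1, …, ψ r` are
added; if no component is in `X \ XA`, then all of `ψ 1, …, ψ s` are added. -/
def IsAdded (G : Digraph V) (X XA : Finset V) (v : V) : Prop :=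
  ∃ (ψ : ℕ → V) (s : ℕ), IsPathInto G ψ s ∧ ψ 1 ∈ XA ∧
    ((∃ r, 1 < r ∧ r ≤ s ∧ ψ r ∈ X \ XA ∧ (∀ i, 1 ≤ i → i < r → ψ i ∉ X \ XA) ∧
        ∃ i, 1 ≤ i ∧ i ≤ r ∧ v = ψ i) ∨
      ((∀ i, 1 ≤ i → i ≤ s → ψ i ∉ X \ XA) ∧ ∃ i, 1 ≤ i ∧ i ≤ s ∧ v = ψ i))

open scoped Classical in
/-- The module (observables and parameters together) formed from the observables `XA` in the
graph `G` with set of observables `X`. -/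
noncomputable def moduleOf (G : Digraph V) (X XA : Finset V) : Finset V :=
  Finset.univ.filter fun v => v ∈ XA ∨ IsAdded G X XA v

end Graph

/-! Marginal and conditional densities of a joint density `p` with respect to the product of the
reference measures `μ v`. A density of a subset of the variables is written as a function of the full
configuration `ψ` that only depends on the coordinates in the subset. -/

section Density

variable {V : Type*} [Fintype V] [DecidableEq V] {E : V → Type*} [∀ v, MeasurableSpace (E v)]

/-- The marginal density of the variables in `S` : all variables outside `S` are integrated out. -/
noncomputable def margDensity (μ : ∀ v, Measure (E v)) (p : (∀ v, E v) → ℝ≥0∞) (S : Finset V) :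
    (∀ v, E v) → ℝ≥0∞ :=
  lmarginal μ Sᶜ p

/-- The conditional density `p(S ∣ T) = p(S, T) / p(T)` of the variables in `S` given those in `T`
(`S` and `T` disjoint). For almost every `ψ`, if the denominator is `0` then so is the numerator,
and the value is `0 / 0 = 0`. -/
noncomputable def condDensity (μ : ∀ v, Measure (E v)) (p : (∀ v, E v) → ℝ≥0∞) (S T : Finset V) :
    (∀ v, E v) → ℝ≥0∞ :=
  fun ψ => margDensity μ p (S ∪ T) ψ / margDensity μ p T ψ

/-- The Markov factorization property with respect to `G` : the joint density is the product of the
conditional densities of the variables given their parents. -/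
def MarkovFactorization (G : Digraph V) (μ : ∀ v, Measure (E v)) (p : (∀ v, E v) → ℝ≥0∞) : Prop :=
  ∀ᵐ ψ ∂(Measure.pi μ), p ψ = ∏ v, condDensity μ p {v} (nodeParents G v) ψ

end Density

end CutInference

namespace CutInference

/-! ### Sinks of a DAG and parent closure of modules. -/

section Graph

variable {V : Type*} [Fintype V] {G : Digraph V}

/-! A module contains the parents of each of its nodes that is not a foreign observable
(`mem_moduleOf_of_adj`). Hence `A ∪ B` is ancestral: its marginal is the product of its Markov
factors (`MarkovFactorization.margDensity_ae_eq`), and the remaining parameters split off as a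
conditional given their parents (`MarkovFactorization.eq_condDensity_mul`). Inside `A ∪ B`, the
factors of X_B^* and Θ_{B∖A} involve only `B`, all others only `A`. Such a product makes Θ_{B∖A}
independent of `A \ B` given the rest of `B` (`margDensity_union_eq_condDensity_mul`). What is left
is p(Θ_A, X); dividing by p(X) gives the first formula, and exchanging the modules gives the second.

The analytic difficulty is that p(S ∣ T) integrates to 1 only where p(T) is neither 0 nor ∞, and to
0 elsewhere. Products of factors therefore have integral at most 1, and the formula for ancestral
marginals comes from a one-sided bound combined with a comparison of total masses
(`ae_eq_of_ae_le_of_lmarginal_le`). -/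

theorem IsDAG.notMem_nodeParents (hG : IsDAG G) (v : V) : v ∉ nodeParents G v := by
  intro h
  exact hG v (.single (by simpa [nodeParents] using h))

/-- Every nonempty set of nodes of a DAG has a sink. -/
theorem IsDAG.exists_sink (hG : IsDAG G) {S : Finset V} (hS : S.Nonempty) :
    ∃ v ∈ S, ∀ w ∈ S, ¬ G.Adj v w := by
  let r : V → V → Prop := fun x y => Relation.TransGen G.Adj y x
  have : IsTrans V r := ⟨fun a b c hab hbc => hbc.trans hab⟩
  have : Std.Irrefl r := ⟨hG⟩
  obtain ⟨v, hv, hmin⟩ := (Finite.wellFounded_of_trans_of_irrefl r).has_min (S : Set V) hS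
  exact ⟨v, hv, fun w hw h => hmin w hw (.single h)⟩

/-- A module contains the parents of its nodes, foreign observables excepted. -/
theorem mem_moduleOf_of_adj [DecidableEq V] {X XA : Finset V} {a b : V} (hb : b ∈ moduleOf G X XA)
    (hbX : b ∉ X \ XA) (hab : G.Adj a b) : a ∈ moduleOf G X XA := by
  -- An initial segment that avoids foreign observables and ends at `b` can be prolonged by `a`.
  -- Length `i = 1` is allowed, which covers `b ∈ XA`.
  have key : ∀ (ψ : ℕ → V) (i : ℕ), 1 ≤ i → (∀ j, 1 ≤ j → j < i → G.Adj (ψ (j + 1)) (ψ j)) →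
      ψ 1 ∈ XA → (∀ j, 1 ≤ j → j ≤ i → ψ j ∉ X \ XA) → ψ i = b → IsAdded G X XA a := by
    intro ψ i hi hpath h1 hout hib
    have hlt : ∀ j ≤ i, Function.update ψ (i + 1) a j = ψ j := fun j hj =>
      Function.update_of_ne (by omega) _ _
    have hlast : Function.update ψ (i + 1) a (i + 1) = a := Function.update_self _ _ _
    refine ⟨Function.update ψ (i + 1) a, i + 1, ⟨by omega, ?_⟩, by rwa [hlt 1 hi], ?_⟩
    · intro j hj hji
      rcases Nat.lt_or_ge j i with h | h
      · rw [hlt _ h, hlt _ h.le]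
        exact hpath j hj h
      · obtain rfl : j = i := by omega
        rw [hlast, hlt _ le_rfl, hib]
        exact hab
    -- If `a` is foreign, it is the first foreign component, so the cut is at `r = i + 1` and still
    -- includes `a`.
    · by_cases ha : a ∈ X \ XA
      · refine Or.inl ⟨i + 1, by omega, le_rfl, by rwa [hlast], ?_, i + 1, by omega, le_rfl,
          hlast.symm⟩
        intro j hj hji
        rw [hlt j (by omega)]
        exact hout j hj (by omega)
      · refine Or.inr ⟨?_, i + 1, by omega, le_rfl, hlast.symm⟩
        intro j hj hji
        rcases Nat.lt_or_ge i j with h | h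
        · obtain rfl : j = i + 1 := by omega
          rwa [hlast]
        · rw [hlt j h]
          exact hout j hj h
  simp only [moduleOf, Finset.mem_filter, Finset.mem_univ, true_and] at hb ⊢
  right
  rcases hb with hb | ⟨ψ, s, ⟨-, hpath⟩, h1, h⟩
  · exact key (fun _ => b) 1 le_rfl (fun j h h' => by omega) hb (fun _ _ _ => hbX) rfl
  · rcases h with ⟨r, -, hrs, hr, hout, i, hi, hir, rfl⟩ | ⟨hout, i, hi, his, rfl⟩
    -- Since `b` is not foreign, it lies strictly before the cut, so the segment up to `b` avoids
    -- foreign observables.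
    · have hne : i ≠ r := by rintro rfl; exact hbX hr
      exact key ψ i hi (fun j hj hji => hpath j hj (by omega)) h1
        (fun j hj hji => hout j hj (by omega)) rfl
    · exact key ψ i hi (fun j hj hji => hpath j hj (by omega)) h1
        (fun j hj hji => hout j hj (by omega)) rfl

theorem subset_moduleOf [DecidableEq V] (X XA : Finset V) : XA ⊆ moduleOf G X XA := by
  intro v hv
  simp [moduleOf, hv]

end Graph

/-! ### Set identities for the blocks of variables. -/

section FinsetAlgebra

variable {V : Type*} [Fintype V] [DecidableEq V] (X A B : Finset V)

theorem compl_inter_eq_sdiff : Xᶜ ∩ A = A \ X := by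
  rw [Finset.inter_comm, Finset.sdiff_eq_inter_compl]

theorem compl_inter_sdiff_eq : Xᶜ ∩ (B \ A) = B \ (A ∪ X) := by
  ext v
  simp only [Finset.mem_inter, Finset.mem_compl, Finset.mem_sdiff, Finset.mem_union]
  tauto

/-- The conditioning variables are exactly those of `B` other than Θ_{B∖A}. -/
theorem conditioning_set_eq :
    (Xᶜ ∩ (A ∩ B)) ∪ (X ∩ (B \ A)) ∪ (X ∩ (A ∩ B)) = B \ (B \ (A ∪ X)) := by
  ext v
  simp only [Finset.mem_inter, Finset.mem_compl, Finset.mem_sdiff, Finset.mem_union]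
  tauto

end FinsetAlgebra

/-! ### Partial integrals and dependence on coordinates. -/

section Density

variable {V : Type*} {E : V → Type*}

theorem dependsOn_prod {ι : Type*} {s : Set V} {f : ι → (∀ v, E v) → ℝ≥0∞} {t : Finset ι}
    (hf : ∀ i ∈ t, DependsOn (f i) s) : DependsOn (∏ i ∈ t, f i) s := fun x y h => by
  simp only [Finset.prod_apply]
  exact Finset.prod_congr rfl fun i hi => hf i hi h

variable [DecidableEq V] [∀ v, MeasurableSpace (E v)] {μ : ∀ v, Measure (E v)}

theorem dependsOn_lmarginal (s : Finset V) (f : (∀ v, E v) → ℝ≥0∞) :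
    DependsOn (lmarginal μ s f) (s : Set V)ᶜ := fun x y h =>
  lmarginal_congr μ f fun i hi => h i (by simpa using hi)

theorem dependsOn_lmarginal_of_dependsOn (s : Finset V) {S : Set V} {f : (∀ v, E v) → ℝ≥0∞}
    (hf : DependsOn f S) : DependsOn (lmarginal μ s f) S := fun x y h => by
  refine lintegral_congr fun z => hf fun i hi => ?_
  simp only [Function.updateFinset_def]
  split_ifs
  · rfl
  · exact h i hi

/-- A factor that does not depend on the variables that are integrated out can be pulled out. -/
theorem lmarginal_mul_left {s : Finset V} {f g : (∀ v, E v) → ℝ≥0∞}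
    (hf : DependsOn f (s : Set V)ᶜ) (hg : Measurable g) :
    lmarginal μ s (f * g) = f * lmarginal μ s g := by
  ext x
  have h : ∀ y, f (Function.updateFinset x s y) = f x := fun y => hf fun i hi => by
    have : i ∉ s := by simpa using hi
    simp [Function.updateFinset_def, this]
  simp only [lmarginal, Pi.mul_apply, h]
  rw [lintegral_const_mul]
  exact hg.comp measurable_updateFinset

theorem lmarginal_mul_right {s : Finset V} {f g : (∀ v, E v) → ℝ≥0∞}
    (hg : DependsOn g (s : Set V)ᶜ) (hf : Measurable f) :
    lmarginal μ s (f * g) = lmarginal μ s f * g := by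
  rw [mul_comm, lmarginal_mul_left hg hf, mul_comm]

theorem lmarginal_zero (s : Finset V) : lmarginal μ s (0 : (∀ v, E v) → ℝ≥0∞) = 0 := by
  ext x
  simp [lmarginal]

variable [Fintype V] {p : (∀ v, E v) → ℝ≥0∞} {G : Digraph V}

theorem dependsOn_margDensity (S : Finset V) : DependsOn (margDensity μ p S) (S : Set V) := by
  simpa [margDensity] using dependsOn_lmarginal (μ := μ) Sᶜ p

theorem dependsOn_condDensity (S T : Finset V) :
    DependsOn (condDensity μ p S T) ((S ∪ T : Finset V) : Set V) := fun x y h => by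
  simp only [condDensity]
  rw [dependsOn_margDensity (S ∪ T) h,
    dependsOn_margDensity T fun i hi => h i (by
      simp only [Finset.coe_union, Set.mem_union]; exact Or.inr hi)]

/-- The product of the conditional densities of the nodes in `S` given their parents. -/
noncomputable def factorProd (G : Digraph V) (μ : ∀ v, Measure (E v)) (p : (∀ v, E v) → ℝ≥0∞)
    (S : Finset V) : (∀ v, E v) → ℝ≥0∞ :=
  ∏ v ∈ S, condDensity μ p {v} (nodeParents G v)

theorem factorProd_union {S T : Finset V} (h : Disjoint S T) :
    factorProd G μ p (S ∪ T) = factorProd G μ p S * factorProd G μ p T :=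
  Finset.prod_union h

theorem dependsOn_factorProd {S T : Finset V} (hST : S ⊆ T)
    (hpa : ∀ v ∈ S, ∀ a, G.Adj a v → a ∈ T) : DependsOn (factorProd G μ p S) (T : Set V) := by
  refine dependsOn_prod fun v hv => (dependsOn_condDensity {v} (nodeParents G v)).mono ?_
  intro a ha
  simp only [nodeParents, Finset.coe_union, Finset.coe_singleton, Finset.coe_filter,
    Finset.mem_univ, true_and, Set.singleton_union, Set.mem_insert_iff, Set.mem_ofPred_eq] at ha
  rcases ha with rfl | ha
  · exact hST hv
  · exact hpa v hv a ha

theorem MarkovFactorization.ae_eq (hM : MarkovFactorization G μ p) :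
    p =ᵐ[Measure.pi μ] factorProd G μ p Finset.univ := by
  filter_upwards [hM] with ψ h
  simpa [factorProd] using h

/-! ### Almost everywhere statements under partial integration. -/

variable [∀ v, SigmaFinite (μ v)]

/-- Integrating `lmarginal μ s f` over `s` once more multiplies it by the mass `c` of the
`s`-coordinates, so its full integral is `c` times that of `f`. -/
theorem ae_eq_zero_of_lmarginal_eq_zero {s : Finset V} {f : (∀ v, E v) → ℝ≥0∞}
    (hf : Measurable f) (h : lmarginal μ s f =ᵐ[Measure.pi μ] 0) : f =ᵐ[Measure.pi μ] 0 := by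
  rw [← lintegral_eq_zero_iff hf]
  rw [← lintegral_eq_zero_iff (hf.lmarginal μ)] at h
  rcases isEmpty_or_nonempty (∀ v, E v) with he | ⟨⟨x⟩⟩
  · simp
  have hsplit : ∀ g : (∀ v, E v) → ℝ≥0∞, Measurable g →
      ∫⁻ y, g y ∂(Measure.pi μ) = lmarginal μ sᶜ (lmarginal μ s g) x := by
    intro g hg
    rw [lintegral_eq_lmarginal_univ x, ← Finset.union_compl s,
      lmarginal_union' μ g hg disjoint_compl_right]
  set c : ℝ≥0∞ := Measure.pi (fun i : s => μ i) Set.univ with hc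
  have hone : lmarginal μ s (fun _ => 1) = fun _ => c := by
    ext y
    simp [lmarginal, hc]
  have hsq : lmarginal μ s (lmarginal μ s f) = (fun _ => c) * lmarginal μ s f := by
    conv_lhs => rw [← mul_one (lmarginal μ s f)]
    rw [lmarginal_mul_left (dependsOn_lmarginal s f) measurable_one, mul_comm]
    exact congrArg (· * lmarginal μ s f) hone
  have hpull : lmarginal μ sᶜ ((fun _ => c) * lmarginal μ s f) =
      (fun _ => c) * lmarginal μ sᶜ (lmarginal μ s f) :=
    lmarginal_mul_left (fun _ _ _ => rfl) (hf.lmarginal μ)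
  rw [hsplit _ hf]
  -- If `c = 0`, nothing can be cancelled, but then every integral over `s` vanishes.
  by_cases hc0 : c = 0
  · have : lmarginal μ s f = 0 := by
      ext y
      rw [hc, Measure.measure_univ_eq_zero] at hc0
      simp [lmarginal, hc0]
    rw [this, lmarginal_zero]
    rfl
  · rw [hsplit _ (hf.lmarginal μ), hsq, hpull, Pi.mul_apply, mul_eq_zero] at h
    exact h.resolve_left hc0

theorem lmarginal_ae_eq_zero (s : Finset V) {f : (∀ v, E v) → ℝ≥0∞}
    (hf : Measurable f) (h : f =ᵐ[Measure.pi μ] 0) : lmarginal μ s f =ᵐ[Measure.pi μ] 0 := by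
  rw [← lintegral_eq_zero_iff hf] at h
  apply ae_eq_zero_of_lmarginal_eq_zero (s := sᶜ) (hf.lmarginal μ)
  refine .of_forall fun x => ?_
  rw [← lmarginal_union μ f hf disjoint_compl_left, Finset.union_comm, Finset.union_compl,
    ← lintegral_eq_lmarginal_univ, h]
  rfl

theorem lmarginal_mono_ae (s : Finset V) {f g : (∀ v, E v) → ℝ≥0∞} (hf : Measurable f)
    (hg : Measurable g) (h : f ≤ᵐ[Measure.pi μ] g) :
    lmarginal μ s f ≤ᵐ[Measure.pi μ] lmarginal μ s g := by
  have h0 : f - g =ᵐ[Measure.pi μ] 0 := by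
    filter_upwards [h] with x hx
    exact tsub_eq_zero_of_le hx
  have hle : f ≤ g + (f - g) := fun x => le_add_tsub
  filter_upwards [lmarginal_ae_eq_zero s (hf.sub hg) h0] with x hx
  calc lmarginal μ s f x ≤ lmarginal μ s (g + (f - g)) x := lmarginal_mono hle x
    _ = lmarginal μ s g x + lmarginal μ s (f - g) x :=
      lintegral_add_left (hg.comp measurable_updateFinset) _
    _ = lmarginal μ s g x := by rw [hx]; simp

theorem lmarginal_congr_ae (s : Finset V) {f g : (∀ v, E v) → ℝ≥0∞} (hf : Measurable f)
    (hg : Measurable g) (h : f =ᵐ[Measure.pi μ] g) :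
    lmarginal μ s f =ᵐ[Measure.pi μ] lmarginal μ s g :=
  (lmarginal_mono_ae s hf hg h.le).antisymm (lmarginal_mono_ae s hg hf h.symm.le)

/-- The gap `g - f` has zero partial integral, because the finite integral of `f` can be cancelled.
-/
theorem ae_eq_of_ae_le_of_lmarginal_le {s : Finset V} {f g : (∀ v, E v) → ℝ≥0∞}
    (hf : Measurable f) (hg : Measurable g) (hfg : f ≤ᵐ[Measure.pi μ] g)
    (hfin : ∀ᵐ x ∂(Measure.pi μ), lmarginal μ s f x ≠ ∞)
    (hle : lmarginal μ s g ≤ᵐ[Measure.pi μ] lmarginal μ s f) : f =ᵐ[Measure.pi μ] g := by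
  have hsum : f + (g - f) =ᵐ[Measure.pi μ] g := by
    filter_upwards [hfg] with x hx
    exact add_tsub_cancel_of_le hx
  have h0 : lmarginal μ s (g - f) =ᵐ[Measure.pi μ] 0 := by
    filter_upwards [lmarginal_congr_ae s (hf.add (hg.sub hf)) hg hsum, hfin, hle] with x h1 h2 h3
    have h4 : lmarginal μ s (f + (g - f)) x = lmarginal μ s f x + lmarginal μ s (g - f) x :=
      lintegral_add_left (hf.comp measurable_updateFinset) _
    rw [h4] at h1
    rw [← h1] at h3
    exact nonpos_iff_eq_zero.1 (ENNReal.le_of_add_le_add_left h2 (by simpa using h3))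
  filter_upwards [hfg, ae_eq_zero_of_lmarginal_eq_zero (hg.sub hf) h0] with x h1 h2
  exact h1.antisymm (tsub_eq_zero_iff_le.1 h2)

/-- The indicator of the zero set of the partial integral does not depend on `s`, so it passes
through the integration. This is what makes the convention 0 / 0 = 0 harmless. -/
theorem ae_eq_zero_of_lmarginal_apply_eq_zero (s : Finset V) {f : (∀ v, E v) → ℝ≥0∞}
    (hf : Measurable f) : ∀ᵐ x ∂(Measure.pi μ), lmarginal μ s f x = 0 → f x = 0 := by
  let i : (∀ v, E v) → ℝ≥0∞ := {x | lmarginal μ s f x = 0}.indicator 1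
  have hi : DependsOn i (s : Set V)ᶜ := fun x y h => by
    simp only [i, Set.indicator_apply, Set.mem_ofPred_eq, dependsOn_lmarginal s f h]
    rfl
  have hset : MeasurableSet {x | lmarginal μ s f x = 0} := hf.lmarginal μ (measurableSet_singleton 0)
  have him : Measurable i := measurable_one.indicator hset
  have h0 : lmarginal μ s (i * f) = 0 := by
    rw [lmarginal_mul_left hi hf]
    ext x
    by_cases hx : lmarginal μ s f x = 0 <;> simp [i, hx]
  filter_upwards [ae_eq_zero_of_lmarginal_eq_zero (him.mul hf) (.of_eq h0)] with x hx hx0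
  simpa [i, hx0] using hx

theorem ae_ne_top_of_lmarginal_ne_top {s : Finset V} {f : (∀ v, E v) → ℝ≥0∞}
    (hf : Measurable f) (h : ∀ x, lmarginal μ s f x ≠ ∞) :
    ∀ᵐ x ∂(Measure.pi μ), f x ≠ ∞ := by
  let i : (∀ v, E v) → ℝ≥0∞ := {x | f x = ∞}.indicator 1
  have hset : MeasurableSet {x | f x = ∞} := hf (measurableSet_singleton ∞)
  have him : Measurable i := measurable_one.indicator hset
  have h0 : lmarginal μ s i = 0 := by
    ext x
    have hx := ae_lt_top (hf.comp (measurable_updateFinset (x := x) (s := s))) (h x)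
    refine (lintegral_eq_zero_iff (him.comp measurable_updateFinset)).2 ?_
    filter_upwards [hx] with y hy
    simp only [Function.comp_apply] at hy
    simp [i, hy.ne]
  filter_upwards [ae_eq_zero_of_lmarginal_eq_zero him (.of_eq h0)] with x hx hx0
  simp [i, hx0] at hx

/-! ### Marginal and conditional densities. -/

theorem measurable_margDensity (hp : Measurable p) (S : Finset V) :
    Measurable (margDensity μ p S) := hp.lmarginal μ

theorem measurable_condDensity (hp : Measurable p) (S T : Finset V) :
    Measurable (condDensity μ p S T) :=
  (measurable_margDensity hp _).div (measurable_margDensity hp _)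

/-- Marginalising in two steps. -/
theorem lmarginal_margDensity (hp : Measurable p) {S T U : Finset V} (hST : Disjoint T U)
    (hU : S = T ∪ U) : lmarginal μ T (margDensity μ p S) = margDensity μ p U := by
  subst hU
  have hd : Disjoint T (T ∪ U)ᶜ := disjoint_compl_right.mono_left Finset.subset_union_left
  rw [margDensity, margDensity, ← lmarginal_union μ p hp hd]
  congr 1
  ext v
  have h : v ∈ T → v ∉ U := fun hv => Finset.disjoint_left.1 hST hv
  simp only [Finset.mem_union, Finset.mem_compl]
  tauto

theorem margDensity_empty (hp_one : ∫⁻ ψ, p ψ ∂(Measure.pi μ) = 1) :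
    margDensity μ p ∅ = fun _ => 1 := by
  simp [margDensity, hp_one]

theorem lmarginal_self_margDensity (hp : Measurable p)
    (hp_one : ∫⁻ ψ, p ψ ∂(Measure.pi μ) = 1) (S : Finset V) :
    lmarginal μ S (margDensity μ p S) = fun _ => 1 := by
  rw [lmarginal_margDensity hp (Finset.disjoint_empty_right S) (by simp),
    margDensity_empty hp_one]

theorem margDensity_ae_ne_top (hp : Measurable p) (hp_one : ∫⁻ ψ, p ψ ∂(Measure.pi μ) = 1)
    (S : Finset V) : ∀ᵐ ψ ∂(Measure.pi μ), margDensity μ p S ψ ≠ ∞ :=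
  ae_ne_top_of_lmarginal_ne_top (s := S) (measurable_margDensity hp S) fun x => by
    rw [lmarginal_self_margDensity hp hp_one]
    exact ENNReal.one_ne_top

theorem margDensity_ae_eq_zero (hp : Measurable p) {S T : Finset V} (hST : S ⊆ T) :
    ∀ᵐ ψ ∂(Measure.pi μ), margDensity μ p S ψ = 0 → margDensity μ p T ψ = 0 := by
  have hm : Measurable (margDensity μ p T) := measurable_margDensity hp T
  have h := ae_eq_zero_of_lmarginal_apply_eq_zero (μ := μ) (T \ S) hm
  rwa [lmarginal_margDensity hp Finset.sdiff_disjoint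
    (Finset.sdiff_union_of_subset hST).symm] at h

/-- The integral is p(T) / p(T), which is 0 rather than 1 where p(T) is 0 or ∞. -/
theorem lmarginal_condDensity_le_one (hp : Measurable p) {S T : Finset V} (hST : Disjoint S T)
    (ψ : ∀ v, E v) : lmarginal μ S (condDensity μ p S T) ψ ≤ 1 := by
  have h : condDensity μ p S T = margDensity μ p (S ∪ T) * (margDensity μ p T)⁻¹ := by
    ext
    simp [condDensity, div_eq_mul_inv]
  have hT : DependsOn (margDensity μ p T)⁻¹ (S : Set V)ᶜ := fun x y hxy => by
    simp only [Pi.inv_apply]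
    rw [dependsOn_margDensity T fun i hi => hxy i fun hi' =>
      Finset.disjoint_left.1 hST hi' hi]
  rw [h, lmarginal_mul_right hT (measurable_margDensity hp _), lmarginal_margDensity hp hST rfl,
    Pi.mul_apply, Pi.inv_apply, ← div_eq_mul_inv]
  exact ENNReal.div_self_le_one

/-! ### Markov factors and conditional independence. -/

theorem measurable_factorProd (hp : Measurable p) (S : Finset V) :
    Measurable (factorProd G μ p S) := by
  unfold factorProd
  rw [Finset.prod_fn]
  exact Finset.measurable_prod _ fun _ _ => measurable_condDensity hp _ _

/-- Integrate out a sink of `S` first: no other factor of `S` depends on it, so its own factor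
contributes at most 1, and induction treats the rest. -/
theorem lmarginal_factorProd_le_one (hG : IsDAG G) (hp : Measurable p) (S : Finset V)
    (ψ : ∀ v, E v) : lmarginal μ S (factorProd G μ p S) ψ ≤ 1 := by
  induction S using Finset.strongInduction generalizing ψ with
  | H S ih =>
    rcases S.eq_empty_or_nonempty with rfl | hS
    · simp [factorProd]
    obtain ⟨v, hv, hsink⟩ := hG.exists_sink hS
    have hd : Disjoint (S.erase v) {v} := by simp
    have hSv : S = S.erase v ∪ {v} := by
      ext a
      by_cases h : a = v <;> simp [h, hv]
    have hdep : DependsOn (factorProd G μ p (S.erase v)) (({v} : Finset V) : Set V)ᶜ := by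
      have := dependsOn_factorProd (G := G) (μ := μ) (p := p) (S := S.erase v) (T := {v}ᶜ)
        (fun a ha => by simpa using Finset.ne_of_mem_erase ha)
        (fun w hw a ha => by
          simp only [Finset.mem_compl, Finset.mem_singleton]
          rintro rfl
          exact hsink w (Finset.mem_of_mem_erase hw) ha)
      simpa using this
    have hcond : Measurable (condDensity μ p {v} (nodeParents G v)) := measurable_condDensity hp _ _
    have hfac : factorProd G μ p S =
        factorProd G μ p (S.erase v) * condDensity μ p {v} (nodeParents G v) := by
      conv_lhs => rw [hSv, factorProd_union hd]
      simp [factorProd]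
    have hm : Measurable (factorProd G μ p S) := measurable_factorProd hp S
    have hsplit : lmarginal μ S (factorProd G μ p S) =
        lmarginal μ (S.erase v) (lmarginal μ {v} (factorProd G μ p S)) := by
      rw [← lmarginal_union μ _ hm hd, ← hSv]
    rw [hsplit, hfac, lmarginal_mul_left hdep hcond]
    refine (lmarginal_mono (g := factorProd G μ p (S.erase v)) (fun x => ?_) ψ).trans
      (ih _ (Finset.erase_ssubset hv) ψ)
    have := lmarginal_condDensity_le_one (μ := μ) hp
      (Finset.disjoint_singleton_left.2 (hG.notMem_nodeParents v)) x
    exact mul_le_of_le_one_right' this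

/-- The marginal density of an ancestral set is the product of its factors. -/
theorem MarkovFactorization.margDensity_ae_eq (hM : MarkovFactorization G μ p) (hG : IsDAG G)
    (hp : Measurable p) (hp_one : ∫⁻ ψ, p ψ ∂(Measure.pi μ) = 1) {S : Finset V}
    (hS : ∀ v ∈ S, ∀ a, G.Adj a v → a ∈ S) :
    margDensity μ p S =ᵐ[Measure.pi μ] factorProd G μ p S := by
  refine ae_eq_of_ae_le_of_lmarginal_le (s := S) (measurable_margDensity hp S)
    (measurable_factorProd hp S) ?_ (.of_forall fun x => ?_) (.of_forall fun x => ?_)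
  -- The factors of `S` do not involve `Sᶜ`, so they come out of the integral over `Sᶜ`; the
  -- remaining integral is at most 1.
  · have h := lmarginal_congr_ae (μ := μ) Sᶜ hp (measurable_factorProd hp Finset.univ) hM.ae_eq
    have hdep : DependsOn (factorProd G μ p S) ((Sᶜ : Finset V) : Set V)ᶜ := by
      simpa using dependsOn_factorProd (G := G) (μ := μ) (p := p) subset_rfl hS
    rw [← Finset.union_compl S, factorProd_union disjoint_compl_right,
      lmarginal_mul_left hdep (measurable_factorProd hp _)] at h
    filter_upwards [h] with x hx
    rw [margDensity, hx]
    exact mul_le_of_le_one_right' (lmarginal_factorProd_le_one hG hp _ x)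
  · simp [lmarginal_self_margDensity hp hp_one]
  · rw [lmarginal_self_margDensity hp hp_one]
    exact lmarginal_factorProd_le_one hG hp S x

/-- The factorization of the joint density along a set `C` of nodes without children outside. -/
theorem MarkovFactorization.eq_condDensity_mul (hM : MarkovFactorization G μ p) (hG : IsDAG G)
    (hp : Measurable p) (hp_one : ∫⁻ ψ, p ψ ∂(Measure.pi μ) = 1) {C : Finset V}
    (hC : ∀ v ∈ C, ∀ w, G.Adj v w → w ∈ C) :
    ∀ᵐ ψ ∂(Measure.pi μ),
      p ψ = condDensity μ p C (parents G C) ψ * margDensity μ p Cᶜ ψ := by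
  have hpaC : parents G C ⊆ Cᶜ := fun a ha => by
    simp only [parents, Finset.mem_filter] at ha
    simpa using ha.2.1
  have hS := hM.margDensity_ae_eq hG hp hp_one (S := Cᶜ) fun v hv a ha => by
    rw [Finset.mem_compl] at hv ⊢
    exact fun h => hv (hC a h v ha)
  have hpF : p =ᵐ[Measure.pi μ] factorProd G μ p C * margDensity μ p Cᶜ := by
    refine hM.ae_eq.trans ?_
    rw [← Finset.union_compl C, factorProd_union disjoint_compl_right]
    filter_upwards [hS] with x hx
    simp only [Pi.mul_apply, hx]
  have hdep : DependsOn (factorProd G μ p C) (((C ∪ parents G C)ᶜ : Finset V) : Set V)ᶜ := by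
    have := dependsOn_factorProd (G := G) (μ := μ) (p := p) (S := C) (T := C ∪ parents G C)
      Finset.subset_union_left fun v hv a ha => by
        by_cases h : a ∈ C
        · simp [h]
        · simp only [parents, Finset.mem_union, Finset.mem_filter, Finset.mem_univ, true_and]
          exact Or.inr ⟨h, v, hv, ha⟩
    rwa [Finset.coe_compl, compl_compl]
  -- Integrating out all but `C` and its parents gives p(C, pa(C)) = F · p(pa(C)), with F the
  -- product of the factors of `C`. So F is the conditional density wherever p(pa(C)) is nonzero and
  -- finite.
  have hmarg := lmarginal_congr_ae (C ∪ parents G C)ᶜ hp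
    ((measurable_factorProd hp C).mul (measurable_margDensity hp Cᶜ)) hpF
  rw [lmarginal_mul_left hdep (measurable_margDensity hp _),
    lmarginal_margDensity hp (U := parents G C)
      (disjoint_compl_left.mono_right Finset.subset_union_right) (by
        ext v
        have := @hpaC v
        simp only [Finset.mem_compl, Finset.mem_union] at this ⊢
        tauto)] at hmarg
  filter_upwards [hpF, hmarg, margDensity_ae_eq_zero hp hpaC,
    margDensity_ae_ne_top hp hp_one (parents G C)] with ψ h1 h2 h3 h4
  change margDensity μ p (C ∪ parents G C) ψ = _ at h2
  rw [h1, condDensity, h2]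
  simp only [Pi.mul_apply]
  by_cases h0 : margDensity μ p (parents G C) ψ = 0
  · simp [h3 h0]
  · rw [ENNReal.mul_div_cancel_right h0 h4]

/-- If the marginal density of `A ∪ B` is a product of a function of `B` and a function of `A`, then
the variables in `D ⊆ B \ A` are independent of those in `A \ B` given those in `B \ D`. -/
theorem margDensity_union_eq_condDensity_mul (hp : Measurable p)
    (hp_one : ∫⁻ ψ, p ψ ∂(Measure.pi μ) = 1) {A B D : Finset V} (hD : D ⊆ B \ A)
    {f g : (∀ v, E v) → ℝ≥0∞} (hf : Measurable f) (hg : Measurable g)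
    (hfB : DependsOn f (B : Set V)) (hgA : DependsOn g (A : Set V))
    (h : margDensity μ p (A ∪ B) =ᵐ[Measure.pi μ] f * g) :
    ∀ᵐ ψ ∂(Measure.pi μ), margDensity μ p (A ∪ B) ψ =
      condDensity μ p D (B \ D) ψ * margDensity μ p ((A ∪ B) \ D) ψ := by
  have hDB : D ⊆ B := hD.trans Finset.sdiff_subset
  have hDA : ∀ v ∈ A, v ∉ D := fun v hv hvD => (Finset.mem_sdiff.1 (hD hvD)).2 hv
  have hgD : DependsOn g (D : Set V)ᶜ := hgA.mono fun v hv => hDA v hv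
  have hfR : DependsOn f ((A \ B : Finset V) : Set V)ᶜ := hfB.mono fun v hv hv' =>
    (Finset.mem_sdiff.1 hv').2 hv
  have hmS := measurable_margDensity (μ := μ) hp (A ∪ B)
  -- With c = ∫ f over `D` and d = ∫ g over `A \ B`, the marginals of `(A ∪ B) \ D`, `B` and `B \ D`
  -- are c·g, f·d and c·d. The claim becomes f·g = (f·d / (c·d)) · (c·g).
  have h1 := lmarginal_congr_ae D hmS (hf.mul hg) h
  rw [lmarginal_mul_right hgD hf, lmarginal_margDensity hp (U := (A ∪ B) \ D)
    Finset.disjoint_sdiff (Finset.union_sdiff_of_subset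
      (hDB.trans Finset.subset_union_right)).symm] at h1
  have h2 := lmarginal_congr_ae (A \ B) hmS (hf.mul hg) h
  rw [lmarginal_mul_left hfR hg, lmarginal_margDensity hp (U := B)
    Finset.sdiff_disjoint (Finset.sdiff_union_self_eq_union).symm] at h2
  have hgRD : DependsOn (lmarginal μ (A \ B) g) (D : Set V)ᶜ :=
    dependsOn_lmarginal_of_dependsOn _ hgD
  have h3 := lmarginal_congr_ae D (measurable_margDensity hp B) (hf.mul (hg.lmarginal μ)) h2
  rw [lmarginal_mul_right hgRD hf, lmarginal_margDensity hp (U := B \ D)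
    Finset.disjoint_sdiff (Finset.union_sdiff_of_subset hDB).symm] at h3
  filter_upwards [h, h1, h2, h3, margDensity_ae_ne_top hp hp_one (B \ D),
    margDensity_ae_eq_zero (S := B \ D) (T := A ∪ B) hp
      (Finset.sdiff_subset.trans Finset.subset_union_right),
    margDensity_ae_eq_zero (S := B \ D) (T := B) hp Finset.sdiff_subset]
    with ψ e e1 e2 e3 hfin hT hTB
  by_cases hT0 : margDensity μ p (B \ D) ψ = 0
  · simp [condDensity, Finset.union_sdiff_of_subset hDB, hT hT0, hTB hT0]
  rw [condDensity, Finset.union_sdiff_of_subset hDB, e2, e3, e, e1]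
  rw [e3] at hT0 hfin
  simp only [Pi.mul_apply] at *
  set a := f ψ
  set b := g ψ
  set c := lmarginal μ D f ψ
  set d := lmarginal μ (A \ B) g ψ
  calc a * b = a * b * ((c * d) * (c * d)⁻¹) := by rw [ENNReal.mul_inv_cancel hT0 hfin, mul_one]
    _ = a * d / (c * d) * (c * b) := by rw [div_eq_mul_inv]; ring

/-- The posterior density splits along the modules `A` and `B`, the latter being updated given the
former. -/
theorem MarkovFactorization.posterior_ae_eq
    (hM : MarkovFactorization G μ p) (hG : IsDAG G) (hp : Measurable p)
    (hp_one : ∫⁻ ψ, p ψ ∂(Measure.pi μ) = 1) {XA XB A B : Finset V} (hdisj : Disjoint XA XB)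
    (hA : A = moduleOf G (XA ∪ XB) XA) (hB : B = moduleOf G (XA ∪ XB) XB) :
    ∀ᵐ ψ ∂(Measure.pi μ),
      condDensity μ p (XA ∪ XB)ᶜ (XA ∪ XB) ψ =
        condDensity μ p (A ∪ B)ᶜ (parents G (A ∪ B)ᶜ) ψ *
        condDensity μ p (B \ (A ∪ (XA ∪ XB))) (B \ (B \ (A ∪ (XA ∪ XB)))) ψ *
        condDensity μ p (A \ (XA ∪ XB)) (XA ∪ XB) ψ := by
  have hXA : XA ⊆ A := hA ▸ subset_moduleOf _ _
  have hXB : XB ⊆ B := hB ▸ subset_moduleOf _ _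
  have hpaA : ∀ v ∈ A, v ∉ XB → ∀ a, G.Adj a v → a ∈ A := by
    intro v hv hvX a ha
    rw [hA] at hv ⊢
    refine mem_moduleOf_of_adj hv (fun h => hvX ?_) ha
    simp only [Finset.mem_sdiff, Finset.mem_union] at h
    tauto
  have hpaB : ∀ v ∈ B, v ∉ XA → ∀ a, G.Adj a v → a ∈ B := by
    intro v hv hvX a ha
    rw [hB] at hv ⊢
    refine mem_moduleOf_of_adj hv (fun h => hvX ?_) ha
    simp only [Finset.mem_sdiff, Finset.mem_union] at h
    tauto
  have hanc : ∀ v ∈ A ∪ B, ∀ a, G.Adj a v → a ∈ A ∪ B := by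
    intro v hv a ha
    have hAB : v ∈ XA → v ∉ XB := fun hv => Finset.disjoint_left.1 hdisj hv
    have h1 := @hXA v
    have h2 := @hXB v
    have h3 := hpaA v
    have h4 := hpaB v
    simp only [Finset.mem_union] at hv ⊢
    by_cases hvB : v ∈ XB
    · exact Or.inr (h4 (h2 hvB) (fun h => hAB h hvB) a ha)
    by_cases hvA : v ∈ XA
    · exact Or.inl (h3 (h1 hvA) hvB a ha)
    rcases hv with hv | hv
    · exact Or.inl (h3 hv hvB a ha)
    · exact Or.inr (h4 hv hvA a ha)
  -- `D` is Θ_{B∖A}.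
  set D := B \ (A ∪ (XA ∪ XB)) with hD
  -- Nodes of `XB` that lie in `A` are counted on the `B` side, since their parents are guaranteed
  -- to lie in `B` only.
  have hsplit : A ∪ B = (D ∪ XB) ∪ (A \ XB) := by
    ext v
    have h1 := @hXA v
    have h2 := @hXB v
    simp only [hD, Finset.mem_union, Finset.mem_sdiff]
    tauto
  have hd : Disjoint (D ∪ XB) (A \ XB) := by
    rw [Finset.disjoint_left]
    intro v
    simp only [hD, Finset.mem_union, Finset.mem_sdiff]
    tauto
  have hfB : DependsOn (factorProd G μ p (D ∪ XB)) (B : Set V) := by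
    have hsub : D ∪ XB ⊆ B := Finset.union_subset Finset.sdiff_subset hXB
    refine dependsOn_factorProd hsub fun v hv => hpaB v (hsub hv) fun hvA => ?_
    rcases Finset.mem_union.1 hv with h | h
    · simp [hD, hvA] at h
    · exact Finset.disjoint_left.1 hdisj hvA h
  have hgA : DependsOn (factorProd G μ p (A \ XB)) (A : Set V) :=
    dependsOn_factorProd Finset.sdiff_subset fun v hv =>
      hpaA v (Finset.mem_sdiff.1 hv).1 (Finset.mem_sdiff.1 hv).2
  have hfac := hM.margDensity_ae_eq hG hp hp_one hanc
  have hfac' : margDensity μ p (A ∪ B) =ᵐ[Measure.pi μ]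
      factorProd G μ p (D ∪ XB) * factorProd G μ p (A \ XB) := by
    rw [← factorProd_union hd, ← hsplit]
    exact hfac
  have hDA : D ⊆ B \ A := Finset.sdiff_subset_sdiff subset_rfl Finset.subset_union_left
  have hchild : ∀ v ∈ (A ∪ B)ᶜ, ∀ w, G.Adj v w → w ∈ (A ∪ B)ᶜ := by
    intro v hv w hw
    rw [Finset.mem_compl] at hv ⊢
    exact fun h => hv (hanc w h v hw)
  have hAX : (A ∪ B) \ D = (A \ (XA ∪ XB)) ∪ (XA ∪ XB) := by
    ext v
    have h1 := @hXA v
    have h2 := @hXB v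
    simp only [hD, Finset.mem_union, Finset.mem_sdiff]
    tauto
  filter_upwards [hM.eq_condDensity_mul hG hp hp_one hchild,
    margDensity_union_eq_condDensity_mul hp hp_one hDA (measurable_factorProd hp _)
      (measurable_factorProd hp _) hfB hgA hfac'] with ψ h1 h2
  rw [compl_compl, h2] at h1
  have huniv : margDensity μ p ((XA ∪ XB)ᶜ ∪ (XA ∪ XB)) ψ = p ψ := by
    rw [Finset.union_comm, Finset.union_compl]
    simp [margDensity]
  -- Dividing by p(X) turns the last marginal, p(Θ_A, X), into p(Θ_A ∣ X).
  conv_lhs => rw [condDensity, huniv, h1, hAX]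
  simp only [condDensity, div_eq_mul_inv]
  ring

end Density

end CutInference

open CutInference in
theorem lemma2 {V : Type*} [Fintype V] [DecidableEq V]
    {E : V → Type*} [∀ v, MeasurableSpace (E v)]
    (μ : ∀ v, Measure (E v)) [∀ v, SigmaFinite (μ v)]
    (p : (∀ v, E v) → ℝ≥0∞) (hp_meas : Measurable p)
    (hp_one : ∫⁻ ψ, p ψ ∂(Measure.pi μ) = 1)
    (G : Digraph V) (hG : IsDAG G) (hMarkov : MarkovFactorization G μ p)
    -- the observables `X`, the parameters `Θ`, and the partition of `X`
    (X Θ XstarA XstarB : Finset V) (hΘ : Θ = Xᶜ)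
    (hX : X = XstarA ∪ XstarB) (hdisj : Disjoint XstarA XstarB)
    -- the two modules
    (A B : Finset V) (hA : A = moduleOf G X XstarA) (hB : B = moduleOf G X XstarB) :
    (∀ᵐ ψ ∂(Measure.pi μ),
      condDensity μ p Θ X ψ =
        condDensity μ p (Θ ∩ (A ∪ B)ᶜ) (parents G (Θ ∩ (A ∪ B)ᶜ)) ψ *
        condDensity μ p (Θ ∩ (B \ A)) ((Θ ∩ (A ∩ B)) ∪ (X ∩ (B \ A)) ∪ (X ∩ (A ∩ B))) ψ *
        condDensity μ p (Θ ∩ A) X ψ) ∧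
    (∀ᵐ ψ ∂(Measure.pi μ),
      condDensity μ p Θ X ψ =
        condDensity μ p (Θ ∩ (A ∪ B)ᶜ) (parents G (Θ ∩ (A ∪ B)ᶜ)) ψ *
        condDensity μ p (Θ ∩ (A \ B)) ((Θ ∩ (A ∩ B)) ∪ (X ∩ (A \ B)) ∪ (X ∩ (A ∩ B))) ψ *
        condDensity μ p (Θ ∩ B) X ψ) := by
  subst hΘ hX
  constructor
  · have hC : (XstarA ∪ XstarB)ᶜ ∩ (A ∪ B)ᶜ = (A ∪ B)ᶜ := by
      refine Finset.inter_eq_right.2 (Finset.compl_subset_compl.2 (Finset.union_subset_union ?_ ?_))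
      · exact hA ▸ subset_moduleOf _ _
      · exact hB ▸ subset_moduleOf _ _
    rw [hC, conditioning_set_eq, compl_inter_sdiff_eq, compl_inter_eq_sdiff]
    exact hMarkov.posterior_ae_eq hG hp_meas hp_one hdisj hA hB
  · have hC : (XstarA ∪ XstarB)ᶜ ∩ (A ∪ B)ᶜ = (B ∪ A)ᶜ := by
      rw [Finset.union_comm B]
      refine Finset.inter_eq_right.2 (Finset.compl_subset_compl.2 (Finset.union_subset_union ?_ ?_))
      · exact hA ▸ subset_moduleOf _ _
      · exact hB ▸ subset_moduleOf _ _
    rw [Finset.union_comm XstarA] at hA hB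
    rw [hC, Finset.inter_comm A B, conditioning_set_eq, compl_inter_sdiff_eq,
      compl_inter_eq_sdiff, Finset.union_comm XstarA]
    exact hMarkov.posterior_ae_eq hG hp_meas hp_one hdisj.symm hB hA
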